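/- Let $n\ge 0$, $\pm[n]=\{-n,\dots,-1,1,\dots,n\}$, and for $x\in\mathbb R^n$ and $1\le i\le n$ put $x_{-i}=-x_i$ and $e_{-i}=-e_i$, where $e_1,\dots,e_n$ is the standard basis. Let $Q_n=\{x\in\mathbb R^n : x_i\le 1 \text{ for all } i\in\pm[n]\}$ be the standard hypercube. Let $\Delta(Q_n)$ be the simplicial complex of all $I\subseteq\pm[n]$ for which the facets $\{x\in Q_n: x_i=1\}$, $i\in I$, have a common point of $Q_n$ (that is, $I$ contains no pair $\{i,-i\}$). A *hypercube graph* $G$ is a graph on $\pm[n]$ whose edges are faces of $\Delta(Q_n)$. A *tube* of $G$ is a face of $\Delta(Q_n)$ inducing a (nonempty) connected subgraph of $G$. A set $N$ of tubes is *nested* if, for any two or more pairwise incomparable members of $N$, their union is a face of $\Delta(Q_n)$ and is not a tube. For a nested set $N$, let $K_N$ be the following cone. Define the preposet $Q(N)$ on $\pm[n]\cup\{\infty\}$ by $x\preceq y$ iff every member of $N$ containing $y$ contains $x$. A *contraction* of a preposet $Q$ is the reflexive transitive closure of $Q\cup R^{op}$ for some relation $R\subseteq Q$. A *ray preposet* is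 a preposet with exactly two equivalence classes, one of which lies strictly below the other. Then $K_N$ is the conic hull of the vectors $\sum_i e_i$, summed over the elements $i\in\pm[n]$ with $i\prec_R\infty$, where $R$ runs over the ray preposets that are contractions of $Q(N)$. Let $\mathcal F(Q_n,\{e_i\}_{i\in\pm[n]},G)$ be the collection of all cones $K_N$, $N$ nested. A *standard-cut hypercube-graph associahedron* of $G$ is a full-dimensional simple polyhedron $P\subseteq\mathbb R^n$ whose dual simplicial complex (the sets of facets with nonempty common intersection in $P$) is isomorphic to the complex of nested sets of tubes of $G$, and whose normal fan equals $\mathcal F(Q_n,\{e_i\}_{i\in\pm[n]},G)$. The normal fan of $P$ consists of the cones $\{v : v\cdot x=\max_{y\in P} v\cdot y \text{ for all } x\in F\}$ for the nonempty faces $F$ of $P$. The *type $B_n$ Coxeter fan* is the fan of the hyperplane arrangement $x_i=0$, $x_i=x_j$, $x_i=-x_j$ ($1\le i<j\le n$). A fan $\mathcal F$ *coarsens* a fan $\mathcal F'$ if every cone of $\mathcal F'$ lies in a cone of $\mathcal F$ and every cone of $\mathcal F$ is a union of cones of $\mathcal F'$. The *type $B_n$ permutahedron* is the convex hull of all signed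 permutations of $(1,2,\dots,n)$. **Proposition.** For every hypercube graph $G$ on $\pm[n]$, the collection $\mathcal F(Q_n,\{e_i\}_{i\in\pm[n]},G)$ coarsens the type $B_n$ Coxeter fan. Consequently, every standard-cut hypercube-graph associahedron $P$ of $G$ has a normal fan that coarsens the type $B_n$ Coxeter fan, and $P$ is a deformation of the type $B_n$ permutahedron: it is a polytope whose normal fan coarsens the normal fan of the type $B_n$ permutahedron. -/

import Mathlib

noncomputable section

namespace NestedFan

/-! ### Polyhedra, faces and normal fans -/

section Polyhedra

variable {E : Type*} [NormedAddCommGroup E] [InnerProductSpace ℝ E]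

/-- A polyhedron: the solution set of finitely many linear inequalities `⟪c, x⟫ ≤ b`. -/
def IsPolyhedron (P : Set E) : Prop :=
  ∃ H : Finset (E × ℝ), P = {x | ∀ h ∈ H, inner ℝ h.1 x ≤ h.2}

/-- A polytope: a bounded polyhedron. -/
def IsPolytope (P : Set E) : Prop :=
  IsPolyhedron P ∧ Bornology.IsBounded P

/-- A nonempty face of `P` (the whole of `P` is allowed): the nonempty set of points of `P` at which
some linear functional attains its maximum over `P`. -/
def IsFace (P F : Set E) : Prop :=
  F.Nonempty ∧ IsExposed ℝ P F

/-- The dimension of the affine hull of a nonempty set. -/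
def faceDim (F : Set E) : ℕ :=
  Module.finrank ℝ (vectorSpan ℝ F)

/-- A facet of a full-dimensional polyhedron: a face of codimension one. -/
def IsFacet (P F : Set E) : Prop :=
  IsFace P F ∧ faceDim F + 1 = Module.finrank ℝ E

/-- A full-dimensional polyhedron is simple if every nonempty face of codimension `k` lies in
exactly `k` facets. -/
def IsSimplePolyhedron (P : Set E) : Prop :=
  IsPolyhedron P ∧ affineSpan ℝ P = ⊤ ∧
    ∀ (F : Set E) (k : ℕ), IsFace P F → faceDim F + k = Module.finrank ℝ E →
      {G : Set E | IsFacet P G ∧ F ⊆ G}.encard = k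

/-- The dual simplicial complex of `P`: the finite sets of facets whose common intersection
is nonempty. The empty set of facets has intersection `P`. -/
def dualComplex (P : Set E) : Set (Finset {F : Set E // IsFacet P F}) :=
  {X | (P ∩ ⋂ F ∈ X, (F : Set E)).Nonempty}

/-- The set of points of `P` where `x ↦ ⟪v, x⟫` is maximal over `P`. -/
def maxFace (P : Set E) (v : E) : Set E :=
  {x ∈ P | ∀ y ∈ P, inner ℝ v y ≤ inner ℝ v x}

/-- The (outer) normal cone of `P` along `F`: the vectors whose maximum over `P` is attained on all
of `F`. -/
def normalCone (P F : Set E) : Set E :=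
  {v | F ⊆ maxFace P v}

/-- The normal fan of `P`: the normal cones of all nonempty faces. -/
def normalFan (P : Set E) : Set (Set E) :=
  {C | ∃ F, IsFace P F ∧ C = normalCone P F}

/-- `Coarsens 𝓕 𝓖`: the fan `𝓕` is a coarsening of the fan `𝓖` (equivalently `𝓖` refines `𝓕`):
every cone of `𝓖` lies in a cone of `𝓕`, and every cone of `𝓕` is a union of cones of `𝓖`. -/
def Coarsens (𝓕 𝓖 : Set (Set E)) : Prop :=
  (∀ D ∈ 𝓖, ∃ C ∈ 𝓕, D ⊆ C) ∧ ∀ C ∈ 𝓕, ∃ 𝓢 ⊆ 𝓖, C = ⋃₀ 𝓢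

/-- `P` is a deformation of the polytope `Q`: it is a polytope whose normal fan coarsens the normal
fan of `Q`. -/
def IsDeformation (P Q : Set E) : Prop :=
  IsPolytope P ∧ Coarsens (normalFan P) (normalFan Q)

/-- The fan of the central hyperplane arrangement with normal vectors `A`. Its cones are the
closures of the strata of the arrangement; the closure of the stratum of `x` consists of the points
`y` for which every `⟪a, y⟫` is zero or has the same sign as `⟪a, x⟫`. -/
def arrangementFan (A : Set E) : Set (Set E) :=
  {C | ∃ x : E, C = {y | ∀ a ∈ A,
    (inner ℝ a x = 0 → inner ℝ a y = 0) ∧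
    (0 < inner ℝ a x → 0 ≤ inner ℝ a y) ∧
    (inner ℝ a x < 0 → inner ℝ a y ≤ 0)}}

end Polyhedra

/-! ### Nested sets and graphs of a simplicial complex

A simplicial complex on the vertex set `S` is given by the family `Δ` of its faces (including the
empty face). -/

section Nested

variable {S : Type*}

/-- A graph on the vertices of `Δ` all of whose edges are faces of `Δ`. -/
structure ComplexGraph [DecidableEq S] (Δ : Set (Finset S)) extends SimpleGraph S where
  edge_mem : ∀ i j, Adj i j → ({i, j} : Finset S) ∈ Δ

/-- The graphical building set: the tubes of the graph, that is, the faces of `Δ` which induce a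
connected (in particular nonempty) subgraph. -/
def tubes [DecidableEq S] {Δ : Set (Finset S)} (G : ComplexGraph Δ) : Set (Finset S) :=
  {t | t ∈ Δ ∧ (G.toSimpleGraph.induce (t : Set S)).Connected}

/-- `N` is a nested set of the building set `B` of `Δ`: any two or more pairwise incomparable
members of `N` have a join in the face poset of `Δ` (their union is a face), not belonging
to `B`. -/
def IsNested [DecidableEq S] (Δ B : Set (Finset S)) (N : Finset (Finset S)) : Prop :=
  (∀ I ∈ N, I ∈ B) ∧
    ∀ N' ⊆ N, 2 ≤ N'.card → IsAntichain (· ⊆ ·) (N' : Set (Finset S)) →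
      N'.biUnion id ∈ Δ ∧ N'.biUnion id ∉ B

/-- The preposet on `S ∪ {∞}` of a family `N` of subsets of `S`: `x ≼ y` if every member of `N`
which contains `y` also contains `x`. The element `∞` is `⊤ : WithTop S`. -/
def familyPreposet (N : Finset (Finset S)) (x y : WithTop S) : Prop :=
  ∀ I ∈ N, (∃ j ∈ I, y = (j : WithTop S)) → ∃ i ∈ I, x = (i : WithTop S)

/-- `Q'` is a contraction of the preposet `Q`: for some relation `R ⊆ Q` it is the reflexive
transitive closure of the union of `Q` and the opposite of `R`. -/
def IsContraction {α : Type*} (Q' Q : α → α → Prop) : Prop :=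
  ∃ R : α → α → Prop, (∀ x y, R x y → Q x y) ∧
    Q' = Relation.ReflTransGen (fun x y => Q x y ∨ R y x)

/-- A ray preposet: a preposet with exactly two equivalence classes, a lower class `L` and an upper
class `Lᶜ`, every element of `L` lying strictly below every element of `Lᶜ`. -/
def IsRayPreposet {α : Type*} (R : α → α → Prop) : Prop :=
  ∃ L : Set α, L.Nonempty ∧ Lᶜ.Nonempty ∧ ∀ x y, R x y ↔ (y ∈ L → x ∈ L)

open Classical in
/-- The finite elements of a preposet on `S ∪ {∞}`: the elements of `S` strictly below `∞`. -/
def finiteElements [Fintype S] (Q : WithTop S → WithTop S → Prop) : Finset S :=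
  Finset.univ.filter fun x : S => Q x ⊤ ∧ ¬ Q ⊤ x

variable {E : Type*} [AddCommGroup E] [Module ℝ E]

/-- The cone of a preposet `Q` on `S ∪ {∞}` with respect to vectors `v s`, `s ∈ S`: the conic hull
of the vectors `∑ v i`, summed over the finite elements `i` of `R`, for all ray contractions
`R` of `Q`. -/
def preposetCone [Fintype S] (v : S → E) (Q : WithTop S → WithTop S → Prop) : Set E :=
  (PointedCone.hull ℝ {w : E | ∃ R : WithTop S → WithTop S → Prop,
    IsRayPreposet R ∧ IsContraction R Q ∧ w = ∑ i ∈ finiteElements R, v i} : Set E)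

/-- The nested set fan of the building set `B` of `Δ`, with respect to the vectors `v`. -/
def nestedSetFan [Fintype S] [DecidableEq S] (Δ : Set (Finset S)) (v : S → E)
    (B : Set (Finset S)) : Set (Set E) :=
  {C | ∃ N, IsNested Δ B N ∧ C = preposetCone v (familyPreposet N)}

end Nested

/-- `P` is a nestohedron of the building set `B` of `Δ`: a simple polyhedron whose dual simplicial
complex is isomorphic to the complex of nested sets of `B`. -/
def IsNestohedron {S : Type*} [DecidableEq S] {E : Type*} [NormedAddCommGroup E]
    [InnerProductSpace ℝ E] (Δ B : Set (Finset S)) (P : Set E) : Prop :=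
  IsSimplePolyhedron P ∧
    ∃ e : {F : Set E // IsFacet P F} ≃ {I : Finset S // I ∈ B},
      ∀ X : Finset {F : Set E // IsFacet P F},
        X ∈ dualComplex P ↔
          IsNested Δ B ((X.map e.toEmbedding).map (Function.Embedding.subtype (· ∈ B)))

/-! ### The hypercube -/

/-- The index set `±[n] = {-n, …, -1, 1, …, n}`; the pair `(i, ε)` stands for `ε · (i + 1)`. -/
abbrev SignedIndex (n : ℕ) : Type := Fin n × ℤˣ

/-- The vectors `e_i`, `i ∈ ±[n]`, where `e_{-i} = -e_i`. -/
def signedBasis (n : ℕ) (s : SignedIndex n) : EuclideanSpace ℝ (Fin n) :=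
  ((s.2 : ℤ) : ℝ) • EuclideanSpace.single s.1 1

/-- The coordinates `x_i`, `i ∈ ±[n]`, where `x_{-i} = -x_i`. -/
def signedCoord {n : ℕ} (x : EuclideanSpace ℝ (Fin n)) (s : SignedIndex n) : ℝ :=
  ((s.2 : ℤ) : ℝ) * x s.1

/-- The standard hypercube `{x | x_i ≤ 1 for all i ∈ ±[n]}`. -/
def hypercube (n : ℕ) : Set (EuclideanSpace ℝ (Fin n)) :=
  {x | ∀ s : SignedIndex n, signedCoord x s ≤ 1}

/-- The dual simplicial complex of the hypercube, whose facet `x_i = 1` is indexed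
by `i ∈ ±[n]`: the sets of indices for which the facets have a common point. -/
def cubeComplex (n : ℕ) : Set (Finset (SignedIndex n)) :=
  {I | ∃ x ∈ hypercube n, ∀ s ∈ I, signedCoord x s = 1}

/-- Hypercube graphs: graphs on `±[n]` whose edges are faces of the dual complex of the hypercube
(that is, graphs without edges `{i, -i}`). -/
abbrev HypercubeGraph (n : ℕ) : Type := ComplexGraph (cubeComplex n)

/-- The fan of nested sets of tubes of `G`, with respect to the facet normals `e_i` of the
hypercube. -/
def hypercubeGraphFan {n : ℕ} (G : HypercubeGraph n) : Set (Set (EuclideanSpace ℝ (Fin n))) :=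
  nestedSetFan (cubeComplex n) (signedBasis n) (tubes G)

/-- A hypercube-graph associahedron of `G`: a nestohedron, over the hypercube, of the graphical
building set. -/
def IsHypercubeGraphAssociahedron {n : ℕ} (G : HypercubeGraph n)
    (P : Set (EuclideanSpace ℝ (Fin n))) : Prop :=
  IsNestohedron (cubeComplex n) (tubes G) P

/-- A standard-cut hypercube-graph associahedron of `G`: one whose normal fan is the nested set fan
of `G` for the vectors `e_i`, `i ∈ ±[n]`. -/
def IsStandardCut {n : ℕ} (G : HypercubeGraph n) (P : Set (EuclideanSpace ℝ (Fin n))) : Prop :=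
  IsHypercubeGraphAssociahedron G P ∧ normalFan P = hypercubeGraphFan G

/-! ### Type `B` -/

/-- Normal vectors of the hyperplanes `x_i = 0`, `x_i = x_j` and `x_i = -x_j`. -/
def typeBNormals (n : ℕ) : Set (EuclideanSpace ℝ (Fin n)) :=
  {a | (∃ i, a = EuclideanSpace.single i 1) ∨
    ∃ i j, i ≠ j ∧ (a = EuclideanSpace.single i 1 - EuclideanSpace.single j 1 ∨
      a = EuclideanSpace.single i 1 + EuclideanSpace.single j 1)}

/-- The type `B_n` Coxeter fan. -/
def typeBCoxeterFan (n : ℕ) : Set (Set (EuclideanSpace ℝ (Fin n))) :=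
  arrangementFan (typeBNormals n)

/-- The type `B_n` permutahedron: the convex hull of all signed permutations of `(1, …, n)`. -/
def typeBPermutahedron (n : ℕ) : Set (EuclideanSpace ℝ (Fin n)) :=
  convexHull ℝ {x | ∃ (σ : Equiv.Perm (Fin n)) (ε : Fin n → ℤˣ),
    ∀ i, x i = ((ε i : ℤ) : ℝ) * (((σ i : ℕ) : ℝ) + 1)}

end NestedFan

end

namespace NestedFan

/-! ### Cones of an arrangement -/

section Arrangement

variable {E : Type*} [NormedAddCommGroup E] [InnerProductSpace ℝ E]

/-! A vector `y` lies in the cone of a nested set `N` exactly when every positive superlevel set `{s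
| t ≤ y_s}` of its signed coordinates is a union of members of `N` (`SuperlevelCovered`, with the
two lemmas on `preposetCone`). This condition sees only signs and comparisons of signed coordinates.
Their weak forms persist on the closure of a type B stratum, so each cone of the fan contains the
stratum closure of each of its points, and is their union. Conversely, for any `x` the connected
components of the positive superlevel sets form a nested set satisfying the condition
(`exists_isNested_superlevelCovered`), so each Coxeter cone lies in a cone of the fan.

For the deformation statement, a signed permutation `p` maximizes `z` over the permutahedron iff
`⟪a, p⟫` and `⟪a, z⟫` never have opposite signs, `a` a type B normal. Reflections give necessity,
rearrangement gives sufficiency; hence the normal fan is the Coxeter fan. Since that fan covers the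
space, so does the normal fan of `P`; every linear functional is then bounded above on `P`, which is
therefore a polytope. -/

/-- The closure of the stratum of `x` in the arrangement with normal vectors `A`. -/
def stratumClosure (A : Set E) (x : E) : Set E :=
  {y | ∀ a ∈ A, (inner ℝ a x = 0 → inner ℝ a y = 0) ∧
    (0 < inner ℝ a x → 0 ≤ inner ℝ a y) ∧ (inner ℝ a x < 0 → inner ℝ a y ≤ 0)}

lemma self_mem_stratumClosure (A : Set E) (x : E) : x ∈ stratumClosure A x :=
  fun _ _ => ⟨id, le_of_lt, le_of_lt⟩

lemma stratumClosure_mem_arrangementFan (A : Set E) (x : E) :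
    stratumClosure A x ∈ arrangementFan A :=
  ⟨x, rfl⟩

lemma inner_nonneg_of_mem_stratumClosure {A : Set E} {a x y : E} (ha : a ∈ A)
    (hy : y ∈ stratumClosure A x) (h : 0 ≤ inner ℝ a x) : 0 ≤ inner ℝ a y := by
  rcases h.eq_or_lt with h | h
  · exact ((hy a ha).1 h.symm).ge
  · exact (hy a ha).2.1 h

lemma inner_nonpos_of_mem_stratumClosure {A : Set E} {a x y : E} (ha : a ∈ A)
    (hy : y ∈ stratumClosure A x) (h : inner ℝ a x ≤ 0) : inner ℝ a y ≤ 0 := by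
  rcases h.eq_or_lt with h | h
  · exact ((hy a ha).1 h).le
  · exact (hy a ha).2.2 h

end Arrangement

/-! ### Signed coordinates -/

section Coordinates

variable {n : ℕ}

/-- The index `-s` of a signed index `s`. -/
def opposite (s : SignedIndex n) : SignedIndex n := (s.1, -s.2)

lemma eq_or_eq_opposite {s r : SignedIndex n} (h : s.1 = r.1) : s = r ∨ s = opposite r := by
  obtain ⟨i, ε⟩ := s
  obtain ⟨j, δ⟩ := r
  obtain rfl : i = j := h
  rcases Int.units_eq_one_or ε with rfl | rfl <;> rcases Int.units_eq_one_or δ with rfl | rfl <;>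
    simp [opposite]

lemma opposite_ne (s : SignedIndex n) : opposite s ≠ s := by
  obtain ⟨i, ε⟩ := s
  rcases Int.units_eq_one_or ε with rfl | rfl <;> simp [opposite]

lemma signedCoord_opposite (x : EuclideanSpace ℝ (Fin n)) (s : SignedIndex n) :
    signedCoord x (opposite s) = -signedCoord x s := by
  simp [signedCoord, opposite]

lemma signedCoord_zero (s : SignedIndex n) :
    signedCoord (0 : EuclideanSpace ℝ (Fin n)) s = 0 := by
  simp [signedCoord]

lemma signedCoord_add (x y : EuclideanSpace ℝ (Fin n)) (s : SignedIndex n) :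
    signedCoord (x + y) s = signedCoord x s + signedCoord y s := by
  simp [signedCoord, mul_add]

lemma signedCoord_smul (c : ℝ) (x : EuclideanSpace ℝ (Fin n)) (s : SignedIndex n) :
    signedCoord (c • x) s = c * signedCoord x s := by
  simp [signedCoord, mul_left_comm]

lemma signedCoord_sum {ι : Type*} (t : Finset ι) (x : ι → EuclideanSpace ℝ (Fin n))
    (s : SignedIndex n) : signedCoord (∑ i ∈ t, x i) s = ∑ i ∈ t, signedCoord (x i) s := by
  simp [signedCoord, Finset.mul_sum]

lemma signedCoord_signedBasis (i s : SignedIndex n) :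
    signedCoord (signedBasis n i) s =
      (if i = s then 1 else 0) - (if i = opposite s then 1 else 0) := by
  by_cases h : i.1 = s.1
  · rcases eq_or_eq_opposite h with rfl | rfl
    · rw [if_pos rfl, if_neg (opposite_ne i).symm]
      rcases Int.units_eq_one_or i.2 with h | h <;> simp [signedCoord, signedBasis, h]
    · rw [if_pos rfl, if_neg (opposite_ne s)]
      rcases Int.units_eq_one_or s.2 with h | h <;>
        simp [signedCoord, signedBasis, h, opposite]
  · have h1 : i ≠ s := fun e => h (by rw [e])
    have h2 : i ≠ opposite s := fun e => h (by rw [e]; rfl)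
    rw [if_neg h1, if_neg h2]
    simp [signedCoord, signedBasis, Ne.symm h]

lemma signedCoord_sum_signedBasis (L : Finset (SignedIndex n)) (s : SignedIndex n) :
    signedCoord (∑ i ∈ L, signedBasis n i) s =
      (if s ∈ L then 1 else 0) - (if opposite s ∈ L then 1 else 0) := by
  simp [signedCoord_sum, signedCoord_signedBasis]

/-- Of each pair `s`, `-s` at most one term survives, so the coefficients are nonnegative and their
positive superlevel sets are those of `y`. -/
lemma sum_max_smul_signedBasis (y : EuclideanSpace ℝ (Fin n)) :
    ∑ s, max (signedCoord y s) 0 • signedBasis n s = y := by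
  rw [Fintype.sum_prod_type]
  have h : ∀ i : Fin n, ∑ ε : ℤˣ, max (signedCoord y (i, ε)) 0 • signedBasis n (i, ε) =
      y i • EuclideanSpace.single i 1 := by
    intro i
    rw [show (Finset.univ : Finset ℤˣ) = {1, -1} from rfl, Finset.sum_pair (by decide)]
    simp only [signedCoord, signedBasis, Units.val_one, Int.cast_one, one_mul, one_smul,
      Units.val_neg, Int.cast_neg, neg_mul, neg_smul, smul_neg, ← sub_eq_add_neg, ← sub_smul]
    congr 1
    rcases le_total (y i) 0 with h | h
    · rw [max_eq_right h, max_eq_left (by linarith)]; ring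
    · rw [max_eq_left h, max_eq_right (by linarith)]; ring
  rw [Finset.sum_congr rfl fun i _ => h i]
  ext j
  simp [Pi.single_apply]

lemma signedCoord_nonpos_of_mem_stratumClosure {x y : EuclideanSpace ℝ (Fin n)}
    (hy : y ∈ stratumClosure (typeBNormals n) x) {s : SignedIndex n} (h : signedCoord x s ≤ 0) :
    signedCoord y s ≤ 0 := by
  have ha : EuclideanSpace.single s.1 (1 : ℝ) ∈ typeBNormals n := Or.inl ⟨_, rfl⟩
  have h1 := inner_nonneg_of_mem_stratumClosure ha hy
  have h2 := inner_nonpos_of_mem_stratumClosure ha hy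
  simp only [EuclideanSpace.inner_single_left, map_one, one_mul] at h1 h2
  rcases Int.units_eq_one_or s.2 with e | e <;> simp [signedCoord, e] at h ⊢
  · exact h2 h
  · exact h1 h

lemma signedCoord_le_of_mem_stratumClosure {x y : EuclideanSpace ℝ (Fin n)}
    (hy : y ∈ stratumClosure (typeBNormals n) x) {s r : SignedIndex n}
    (h : signedCoord x s ≤ signedCoord x r) : signedCoord y s ≤ signedCoord y r := by
  by_cases hsr : s.1 = r.1
  · rcases eq_or_eq_opposite hsr with rfl | rfl
    · exact le_rfl
    -- Comparing opposite indices amounts to a sign condition on one coordinate.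
    · rw [signedCoord_opposite] at h ⊢
      have := signedCoord_nonpos_of_mem_stratumClosure hy (s := opposite r)
        (by rw [signedCoord_opposite]; linarith)
      rw [signedCoord_opposite] at this
      linarith
  · have ha : EuclideanSpace.single s.1 (1 : ℝ) - EuclideanSpace.single r.1 1 ∈ typeBNormals n :=
      Or.inr ⟨_, _, hsr, Or.inl rfl⟩
    have hb : EuclideanSpace.single s.1 (1 : ℝ) + EuclideanSpace.single r.1 1 ∈ typeBNormals n :=
      Or.inr ⟨_, _, hsr, Or.inr rfl⟩
    have h1 := inner_nonneg_of_mem_stratumClosure ha hy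
    have h2 := inner_nonpos_of_mem_stratumClosure ha hy
    have h3 := inner_nonneg_of_mem_stratumClosure hb hy
    have h4 := inner_nonpos_of_mem_stratumClosure hb hy
    simp only [inner_sub_left, inner_add_left, EuclideanSpace.inner_single_left, map_one,
      one_mul] at h1 h2 h3 h4
    rcases Int.units_eq_one_or s.2 with e | e <;> rcases Int.units_eq_one_or r.2 with e' | e' <;>
      simp only [signedCoord, e, e', Units.val_one, Int.cast_one, one_mul, Units.val_neg,
        Int.cast_neg, neg_mul] at h ⊢
    · linarith [h2 (by linarith)]
    · linarith [h4 (by linarith)]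
    · linarith [h3 (by linarith)]
    · linarith [h1 (by linarith)]

lemma mem_cubeComplex_of_pos {I : Finset (SignedIndex n)} (y : EuclideanSpace ℝ (Fin n))
    (h : ∀ s ∈ I, 0 < signedCoord y s) : I ∈ cubeComplex n := by
  -- The sign vector of `y`; its zero coordinates are harmless, since no index of `I` sits there.
  refine ⟨WithLp.toLp 2 fun i => (SignType.sign (y i) : ℝ), fun s => ?_, fun s hs => ?_⟩
  · rcases Int.units_eq_one_or s.2 with e | e <;> rcases lt_trichotomy (y s.1) 0 with h | h | h <;>
      norm_num [signedCoord, e, h, sign_pos, sign_neg]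
  · have := h s hs
    rcases Int.units_eq_one_or s.2 with e | e <;> simp [signedCoord, e] at this ⊢
    · simp [sign_pos this]
    · simp [sign_neg this]

lemma opposite_notMem_of_mem_cubeComplex {I : Finset (SignedIndex n)} (hI : I ∈ cubeComplex n)
    {s : SignedIndex n} (hs : s ∈ I) : opposite s ∉ I := by
  intro h
  obtain ⟨x, -, hx⟩ := hI
  have h1 := hx _ h
  rw [signedCoord_opposite, hx _ hs] at h1
  norm_num at h1

end Coordinates

/-! ### Maximal members of a family of sets -/

section Maximal

variable {S : Type*}

open Classical in
/-- The maximal members of a finite family of finite sets. -/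
noncomputable def maximalMembers (M : Finset (Finset S)) : Finset (Finset S) :=
  M.filter fun J => Maximal (· ∈ M) J

open Classical in
lemma mem_maximalMembers {M : Finset (Finset S)} {J : Finset S} :
    J ∈ maximalMembers M ↔ Maximal (· ∈ M) J := by
  simpa [maximalMembers] using Maximal.prop

lemma maximalMembers_subset (M : Finset (Finset S)) : maximalMembers M ⊆ M :=
  fun _ hJ => (mem_maximalMembers.1 hJ).prop

lemma isAntichain_maximalMembers (M : Finset (Finset S)) :
    IsAntichain (· ⊆ ·) (maximalMembers M : Set (Finset S)) := by
  intro I hI J hJ hne hsub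
  rw [Finset.mem_coe, mem_maximalMembers] at hI hJ
  exact hne (hI.eq_of_le hJ.prop hsub)

lemma biUnion_maximalMembers [DecidableEq S] (M : Finset (Finset S)) :
    (maximalMembers M).biUnion id = M.biUnion id := by
  refine (Finset.biUnion_subset_biUnion_of_subset_left _ (maximalMembers_subset M)).antisymm ?_
  intro s hs
  obtain ⟨I, hI, hsI⟩ := Finset.mem_biUnion.1 hs
  obtain ⟨J, hIJ, hJ⟩ := M.exists_le_maximal hI
  exact Finset.mem_biUnion.2 ⟨J, mem_maximalMembers.2 hJ, hIJ hsI⟩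

end Maximal

open Classical in
/-- A nonnegative combination is a nonnegative combination of the sums over superlevel sets. -/
lemma sum_smul_mem_of_superlevel {S : Type*} [Fintype S] {E : Type*}
    [AddCommGroup E] [Module ℝ E] (C : PointedCone ℝ E) (v : S → E) (g : S → ℝ)
    (hg : ∀ s, 0 ≤ g s)
    (h : ∀ t > 0, ∑ s ∈ Finset.univ.filter (fun s => t ≤ g s), v s ∈ C) :
    ∑ s, g s • v s ∈ C := by
  induction hk : (Finset.univ.filter fun s => 0 < g s).card using Nat.strong_induction_on
    generalizing g with
  | _ k ih =>
    rcases (Finset.univ.filter fun s => 0 < g s).eq_empty_or_nonempty with he | hne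
    · have : ∀ s, g s = 0 := fun s => le_antisymm
        (not_lt.1 fun hs => Finset.notMem_empty s (he ▸ Finset.mem_filter.2 ⟨Finset.mem_univ s, hs⟩))
        (hg s)
      simp [this]
    · obtain ⟨m, hm, hmin⟩ := Finset.exists_min_image _ g hne
      simp only [Finset.mem_filter, Finset.mem_univ, true_and] at hm hmin
      have hcases : ∀ s, g s = 0 ∨ g m ≤ g s := fun s =>
        (hg s).eq_or_lt.imp Eq.symm (hmin s)
      -- Subtracting the least positive value on the whole support shrinks the support, and the
      -- level `t` set of `g'` is the level `t + g m` set of `g`.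
      let g' : S → ℝ := fun s => if g m ≤ g s then g s - g m else 0
      have hg' : ∀ s, 0 ≤ g' s := fun s => by
        simp only [g']; split_ifs with hs <;> linarith
      have hsum : ∑ s, g s • v s = ∑ s, g' s • v s +
          g m • ∑ s ∈ Finset.univ.filter (fun s => g m ≤ g s), v s := by
        rw [Finset.smul_sum, Finset.sum_filter, ← Finset.sum_add_distrib]
        refine Finset.sum_congr rfl fun s _ => ?_
        simp only [g']
        split_ifs with hs
        · rw [← add_smul, sub_add_cancel]
        · rw [(hcases s).resolve_right hs]; simp
      rw [hsum]
      refine C.add_mem (ih _ ?_ g' hg' ?_ rfl) (C.smul_mem hm.le (h _ hm))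
      · rw [← hk]
        refine Finset.card_lt_card ⟨fun s hs => ?_, fun hsub => ?_⟩
        · simp only [Finset.mem_filter, Finset.mem_univ, true_and, g'] at hs ⊢
          split_ifs at hs with h1
          · linarith
          · exact (lt_irrefl _ hs).elim
        · have := hsub (Finset.mem_filter.2 ⟨Finset.mem_univ m, hm⟩)
          simp [g'] at this
      · intro t ht
        have := h (t + g m) (by linarith)
        convert this using 2
        ext s
        simp only [Finset.mem_filter, Finset.mem_univ, true_and, g']
        split_ifs with hs
        · constructor <;> intro _ <;> linarith
        · constructor <;> intro _ <;> linarith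

/-! ### Nested sets of tubes -/

section Nested

open Classical in
lemma finiteElements_ray {S : Type*} [Fintype S] {L : Set (WithTop S)}
    (hL : ⊤ ∉ L) {R : WithTop S → WithTop S → Prop}
    (hR : ∀ x y, R x y ↔ (y ∈ L → x ∈ L)) (s : S) :
    s ∈ finiteElements R ↔ (s : WithTop S) ∈ L := by
  simp [finiteElements, hR, hL]

variable {S : Type*} [DecidableEq S] {Δ : Set (Finset S)} {G : ComplexGraph Δ}

lemma nonempty_of_mem_tubes {t : Finset S} (ht : t ∈ tubes G) : t.Nonempty := by
  obtain ⟨⟨s, hs⟩⟩ := ht.2.nonempty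
  exact ⟨s, hs⟩

/-- Two incomparable members sharing a vertex would have a connected union, hence a tube. -/
lemma subset_or_subset_of_isNested {N : Finset (Finset S)} (hN : IsNested Δ (tubes G) N)
    {I J : Finset S} (hI : I ∈ N) (hJ : J ∈ N) {s : S} (hsI : s ∈ I) (hsJ : s ∈ J) :
    I ⊆ J ∨ J ⊆ I := by
  by_contra! h
  have hne : I ≠ J := fun e => h.1 (e ▸ subset_rfl)
  have hanti : IsAntichain (· ⊆ ·) (({I, J} : Finset (Finset S)) : Set (Finset S)) := by
    rw [Finset.coe_pair]
    rintro A (rfl | rfl) B (rfl | rfl) hAB hsub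
    exacts [hAB rfl, h.1 hsub, h.2 hsub, hAB rfl]
  obtain ⟨h1, h2⟩ := hN.2 {I, J} (by simp [Finset.insert_subset_iff, hI, hJ])
    (Finset.card_pair hne).ge hanti
  refine h2 ⟨h1, ?_⟩
  have e : ((({I, J} : Finset (Finset S)).biUnion id : Finset S) : Set S) = (I : Set S) ∪ J := by
    simp
  rw [e]
  exact SimpleGraph.induce_union_connected (hN.1 I hI).2.preconnected
    (hN.1 J hJ).2.preconnected ⟨s, hsI, hsJ⟩

/-- Otherwise the members strictly inside `I` cover it. Their maximal ones form an antichain of at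
least two, since a single one is proper, and their union is the tube `I`. -/
lemma exists_forall_mem_subset {N : Finset (Finset S)} (hN : IsNested Δ (tubes G) N)
    {I : Finset S} (hI : I ∈ N) : ∃ m ∈ I, ∀ J ∈ N, m ∈ J → I ⊆ J := by
  by_contra! h
  set M := N.filter (· ⊂ I) with hM
  have hU : (maximalMembers M).biUnion id = I := by
    rw [biUnion_maximalMembers]
    ext s
    simp only [Finset.mem_biUnion, id]
    refine ⟨fun ⟨J, hJ, hs⟩ => (Finset.mem_filter.1 hJ).2.1 hs, fun hs => ?_⟩
    obtain ⟨J, hJ, hsJ, hIJ⟩ := h s hs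
    refine ⟨J, Finset.mem_filter.2 ⟨hJ, ?_, hIJ⟩, hsJ⟩
    exact (subset_or_subset_of_isNested hN hI hJ hs hsJ).resolve_left hIJ
  have hsub : maximalMembers M ⊆ N :=
    (maximalMembers_subset M).trans (Finset.filter_subset _ _)
  have hcard : 2 ≤ (maximalMembers M).card := by
    by_contra! hc
    obtain ⟨s, hs⟩ := nonempty_of_mem_tubes (hN.1 I hI)
    rw [← hU] at hs
    obtain ⟨J, hJ, -⟩ := Finset.mem_biUnion.1 hs
    have h1 : maximalMembers M = {J} := (Finset.card_eq_one.1
      (le_antisymm (by omega) (Finset.card_pos.2 ⟨J, hJ⟩))).elim fun a ha => by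
        rw [ha] at hJ ⊢
        rw [Finset.mem_singleton.1 hJ]
    rw [h1, Finset.singleton_biUnion] at hU
    exact (Finset.mem_filter.1 (maximalMembers_subset M hJ)).2.ne hU
  have := (hN.2 _ hsub hcard (isAntichain_maximalMembers M)).2
  rw [hU] at this
  exact this (hN.1 I hI)

variable [Fintype S] {E : Type*} [AddCommGroup E] [Module ℝ E]

/-- The ray preposet with lower class `I` is a contraction: `I` has a greatest element `m` in the
preposet of `N`, and `∞` is greatest overall, so reversing relations collapses `I` onto `m` and the
complement onto `∞`. -/
lemma sum_mem_preposetCone {N : Finset (Finset S)} (hN : IsNested Δ (tubes G) N) (v : S → E)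
    {I : Finset S} (hI : I ∈ N) : ∑ i ∈ I, v i ∈ preposetCone v (familyPreposet N) := by
  obtain ⟨m, hm, hmin⟩ := exists_forall_mem_subset hN hI
  let L : Set (WithTop S) := (fun s : S => (s : WithTop S)) '' (I : Set S)
  have htop : ⊤ ∉ L := by
    rintro ⟨s, -, h⟩
    exact WithTop.coe_ne_top h
  have hmL : (m : WithTop S) ∈ L := ⟨m, hm, rfl⟩
  have hmem : ∀ s : S, (s : WithTop S) ∈ L ↔ s ∈ I := fun s => by simp [L]
  let R : WithTop S → WithTop S → Prop := fun x y => y ∈ L → x ∈ L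
  have hQR : ∀ x y, familyPreposet N x y → R x y := by
    rintro x y h ⟨j, hj, rfl⟩
    obtain ⟨i, hi, rfl⟩ := h I hI ⟨j, hj, rfl⟩
    exact ⟨i, hi, rfl⟩
  have hQm : ∀ x ∈ L, familyPreposet N x m := by
    rintro _ ⟨i, hi, rfl⟩ J hJ ⟨j, hj, hjm⟩
    exact ⟨i, hmin J hJ (WithTop.coe_injective hjm ▸ hj) hi, rfl⟩
  have hQtop : ∀ x, familyPreposet N x ⊤ := by
    rintro x J hJ ⟨j, -, hj⟩
    exact (WithTop.coe_ne_top hj.symm).elim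
  refine PointedCone.subset_hull ⟨R, ⟨L, ⟨_, hmL⟩, ⟨⊤, htop⟩, fun _ _ => Iff.rfl⟩, ?_, ?_⟩
  · refine ⟨fun x y => familyPreposet N x y ∧ R y x, fun x y h => h.1, ?_⟩
    ext x y
    constructor
    · intro h
      by_cases hy : y ∈ L
      · exact .tail (b := (m : WithTop S)) (.single (Or.inl (hQm x (h hy))))
          (Or.inr ⟨hQm y hy, fun _ => hmL⟩)
      · exact .tail (b := ⊤) (.single (Or.inl (hQtop x)))
          (Or.inr ⟨hQtop y, fun h => (hy h).elim⟩)
    · intro h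
      induction h with
      | refl => exact id
      | tail _ h ih => exact fun hc => ih (h.elim (fun h => hQR _ _ h hc) fun h => h.2 hc)
  · refine Finset.sum_congr (Finset.ext fun s => ?_) fun _ _ => rfl
    rw [finiteElements_ray htop (fun _ _ => Iff.rfl), hmem]

/-- The lower class is a down-set avoiding the greatest element `∞`, and an element in no member of
`N` lies above `∞`. -/
lemma finiteElements_of_isContraction {N : Finset (Finset S)}
    {R : WithTop S → WithTop S → Prop} (hR : IsRayPreposet R)
    (hc : IsContraction R (familyPreposet N)) :
    (∀ s ∈ finiteElements R, ∃ I ∈ N, s ∈ I) ∧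
      ∀ r s : S, familyPreposet N r s → s ∈ finiteElements R → r ∈ finiteElements R := by
  obtain ⟨L, -, ⟨c, hcL⟩, hL⟩ := hR
  have hQR : ∀ x y, familyPreposet N x y → (y ∈ L → x ∈ L) := by
    obtain ⟨R₀, -, rfl⟩ := hc
    exact fun x y h => (hL x y).1 (.single (Or.inl h))
  have htop : ⊤ ∉ L := by
    refine fun h => hcL (hQR c ⊤ ?_ h)
    rintro J hJ ⟨j, -, hj⟩
    exact (WithTop.coe_ne_top hj.symm).elim
  simp only [finiteElements_ray htop hL]
  refine ⟨fun s hs => ?_, fun r s h => hQR _ _ h⟩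
  by_contra! h
  refine htop (hQR ⊤ s ?_ hs)
  rintro J hJ ⟨j, hj, hjs⟩
  exact (h J hJ (WithTop.coe_injective hjs ▸ hj)).elim

/-- Maximal members of a nested set are pairwise disjoint, so the sum splits over them. -/
lemma sum_biUnion_mem_preposetCone {N M : Finset (Finset S)} (hN : IsNested Δ (tubes G) N)
    (v : S → E) (hM : M ⊆ N) :
    ∑ i ∈ M.biUnion id, v i ∈ preposetCone v (familyPreposet N) := by
  rw [← biUnion_maximalMembers, Finset.sum_biUnion]
  · exact Submodule.sum_mem _ fun I hI =>
      sum_mem_preposetCone hN v (hM (maximalMembers_subset M hI))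
  · intro I hI J hJ hne
    refine Finset.disjoint_left.2 fun s hsI hsJ => ?_
    rcases subset_or_subset_of_isNested hN (hM (maximalMembers_subset M hI))
      (hM (maximalMembers_subset M hJ)) hsI hsJ with h | h
    · exact isAntichain_maximalMembers M hI hJ hne h
    · exact isAntichain_maximalMembers M hJ hI hne.symm h

end Nested

/-! ### The fan of a hypercube graph -/

section Hypercube

variable {n : ℕ} {G : HypercubeGraph n}

lemma opposite_notMem_of_isNested {N : Finset (Finset (SignedIndex n))}
    (hN : IsNested (cubeComplex n) (tubes G) N) {s : SignedIndex n} {I J : Finset (SignedIndex n)}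
    (hI : I ∈ N) (hs : s ∈ I) (hJ : J ∈ N) : opposite s ∉ J := by
  intro ho
  have hU : (maximalMembers N).biUnion id ∈ cubeComplex n := by
    -- Nestedness makes the union of all members a face only for two or more maximal members; a
    -- single one is itself a face.
    by_cases hc : 2 ≤ (maximalMembers N).card
    · exact (hN.2 _ (maximalMembers_subset N) hc (isAntichain_maximalMembers N)).1
    · obtain h0 | ⟨K, hK⟩ : maximalMembers N = ∅ ∨ ∃ K, maximalMembers N = {K} := by
        rw [← Finset.card_eq_zero, ← Finset.card_eq_one]; omega
      · have hsN : s ∈ N.biUnion id := Finset.mem_biUnion.2 ⟨I, hI, hs⟩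
        rw [← biUnion_maximalMembers, h0] at hsN
        simp at hsN
      · rw [hK, Finset.singleton_biUnion]
        exact (hN.1 K (maximalMembers_subset N (hK ▸ Finset.mem_singleton_self K))).1
  rw [biUnion_maximalMembers] at hU
  exact opposite_notMem_of_mem_cubeComplex hU (Finset.mem_biUnion.2 ⟨I, hI, hs⟩)
    (Finset.mem_biUnion.2 ⟨J, hJ, ho⟩)

/-- Every positive superlevel set of the signed coordinates of `y` is a union of members of `N`. -/
def SuperlevelCovered (N : Finset (Finset (SignedIndex n))) (y : EuclideanSpace ℝ (Fin n)) : Prop :=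
  ∀ s, 0 < signedCoord y s → ∃ I ∈ N, s ∈ I ∧ ∀ r ∈ I, signedCoord y s ≤ signedCoord y r

lemma SuperlevelCovered.of_mem_stratumClosure {N : Finset (Finset (SignedIndex n))}
    {x y : EuclideanSpace ℝ (Fin n)} (hx : SuperlevelCovered N x)
    (hy : y ∈ stratumClosure (typeBNormals n) x) : SuperlevelCovered N y := by
  intro s hs
  have hsx : 0 < signedCoord x s :=
    not_le.1 fun h => hs.not_ge (signedCoord_nonpos_of_mem_stratumClosure hy h)
  obtain ⟨I, hI, hsI, h⟩ := hx s hsx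
  exact ⟨I, hI, hsI, fun r hr => signedCoord_le_of_mem_stratumClosure hy (h r hr)⟩

lemma SuperlevelCovered.mem_preposetCone {N : Finset (Finset (SignedIndex n))}
    (hN : IsNested (cubeComplex n) (tubes G) N) {y : EuclideanSpace ℝ (Fin n)}
    (hy : SuperlevelCovered N y) :
    y ∈ preposetCone (signedBasis n) (familyPreposet N) := by
  classical
  rw [← sum_max_smul_signedBasis y]
  refine sum_smul_mem_of_superlevel (PointedCone.hull ℝ _) _ _ (fun s => le_max_right _ _)
    fun t ht => ?_
  -- The level `t` set is the union of the members of `N` on which `y` is at least `t`.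
  have hL : Finset.univ.filter (fun s => t ≤ max (signedCoord y s) 0) =
      (N.filter fun I => ∀ r ∈ I, t ≤ signedCoord y r).biUnion id := by
    ext s
    simp only [Finset.mem_filter, Finset.mem_univ, true_and, le_max_iff, ht.not_ge, or_false,
      Finset.mem_biUnion, id]
    constructor
    · intro hs
      obtain ⟨I, hI, hsI, h⟩ := hy s (ht.trans_le hs)
      exact ⟨I, ⟨hI, fun r hr => hs.trans (h r hr)⟩, hsI⟩
    · rintro ⟨I, ⟨-, h⟩, hs⟩
      exact h s hs
  have h := sum_biUnion_mem_preposetCone hN (signedBasis n)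
    (Finset.filter_subset (fun I => ∀ r ∈ I, t ≤ signedCoord y r) N)
  rw [← hL] at h
  convert SetLike.mem_coe.1 h

lemma SuperlevelCovered.of_mem_preposetCone {N : Finset (Finset (SignedIndex n))}
    (hN : IsNested (cubeComplex n) (tubes G) N) {y : EuclideanSpace ℝ (Fin n)}
    (hy : y ∈ preposetCone (signedBasis n) (familyPreposet N)) : SuperlevelCovered N y := by
  -- These inequalities hold on generators and survive conic combinations. Monotonicity is
  -- restricted to `s` covered by `N`: an uncovered `s` lies above every `r`, even one with negative
  -- coordinate.
  have key : (∀ s, 0 < signedCoord y s → ∃ I ∈ N, s ∈ I) ∧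
      ∀ r s : SignedIndex n, (∃ I ∈ N, s ∈ I) → familyPreposet N r s →
        signedCoord y s ≤ signedCoord y r := by
    refine Submodule.span_induction ?_ ?_ ?_ ?_ hy
    · rintro _ ⟨R, hR, hc, rfl⟩
      obtain ⟨h1, h2⟩ := finiteElements_of_isContraction hR hc
      simp only [signedCoord_sum_signedBasis]
      refine ⟨fun s hs => h1 s ?_, fun r s ⟨I, hI, hsI⟩ hrs => ?_⟩
      · by_contra h
        rw [if_neg h] at hs
        split_ifs at hs <;> norm_num at hs
      · obtain ⟨r', hr', e⟩ := hrs I hI ⟨s, hsI, rfl⟩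
        obtain rfl : r = r' := WithTop.coe_injective e
        have hro : opposite r ∉ finiteElements R := fun h => by
          obtain ⟨J, hJ, hrJ⟩ := h1 _ h
          exact opposite_notMem_of_isNested hN hI hr' hJ hrJ
        have hso : opposite s ∉ finiteElements R := fun h => by
          obtain ⟨J, hJ, hsJ⟩ := h1 _ h
          exact opposite_notMem_of_isNested hN hI hsI hJ hsJ
        have := h2 r s hrs
        split_ifs <;> simp_all
    · simp [signedCoord_zero]
    · rintro x z - - ⟨hx1, hx2⟩ ⟨hz1, hz2⟩
      simp only [signedCoord_add]
      refine ⟨fun s hs => ?_, fun r s hs hrs => add_le_add (hx2 r s hs hrs) (hz2 r s hs hrs)⟩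
      by_contra h
      have h1 : signedCoord x s ≤ 0 := not_lt.1 fun h' => h (hx1 s h')
      have h2 : signedCoord z s ≤ 0 := not_lt.1 fun h' => h (hz1 s h')
      linarith
    · rintro ⟨c, hc⟩ x - ⟨hx1, hx2⟩
      have e : ∀ s, signedCoord ((⟨c, hc⟩ : NNReal) • x) s = c * signedCoord x s :=
        signedCoord_smul c x
      simp only [e]
      exact ⟨fun s hs => hx1 s (pos_of_mul_pos_right hs hc),
        fun r s hs hrs => mul_le_mul_of_nonneg_left (hx2 r s hs hrs) hc⟩
  intro s hs
  obtain ⟨I₀, hI₀, hsI₀⟩ := key.1 s hs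
  -- The members containing `s` form a chain, so every element of the smallest one precedes `s` in
  -- the preposet.
  obtain ⟨I, hI⟩ := (N.filter (s ∈ ·)).exists_minimal ⟨I₀, Finset.mem_filter.2 ⟨hI₀, hsI₀⟩⟩
  obtain ⟨hIN, hsI⟩ := Finset.mem_filter.1 hI.prop
  refine ⟨I, hIN, hsI, fun r hr => key.2 r s ⟨I, hIN, hsI⟩ ?_⟩
  rintro J hJ ⟨j, hj, e⟩
  obtain rfl : s = j := WithTop.coe_injective e
  refine ⟨r, ?_, rfl⟩
  rcases subset_or_subset_of_isNested hN hIN hJ hsI hj with h | h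
  · exact h hr
  · exact hI.le_of_le (Finset.mem_filter.2 ⟨hJ, hj⟩) h hr

open Classical in
/-- The union of the tubes containing `s` on which the signed coordinates of `y` are at least that
of `s`: the connected component of `s` in a superlevel set. -/
noncomputable def levelTube (G : HypercubeGraph n) (y : EuclideanSpace ℝ (Fin n))
    (s : SignedIndex n) : Finset (SignedIndex n) :=
  Finset.univ.filter fun r =>
    ∃ t ∈ tubes G, s ∈ t ∧ (∀ q ∈ t, signedCoord y s ≤ signedCoord y q) ∧ r ∈ t

lemma mem_levelTube {y : EuclideanSpace ℝ (Fin n)} {s r : SignedIndex n} :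
    r ∈ levelTube G y s ↔
      ∃ t ∈ tubes G, s ∈ t ∧ (∀ q ∈ t, signedCoord y s ≤ signedCoord y q) ∧ r ∈ t := by
  simp [levelTube]

lemma le_of_mem_levelTube {y : EuclideanSpace ℝ (Fin n)} {s r : SignedIndex n}
    (h : r ∈ levelTube G y s) : signedCoord y s ≤ signedCoord y r := by
  obtain ⟨t, -, -, ht, hr⟩ := mem_levelTube.1 h
  exact ht r hr

lemma self_mem_levelTube {y : EuclideanSpace ℝ (Fin n)} {s : SignedIndex n}
    (hs : 0 < signedCoord y s) : s ∈ levelTube G y s := by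
  refine mem_levelTube.2 ⟨{s}, ⟨mem_cubeComplex_of_pos y (by simpa), ?_⟩, by simp⟩
  rw [Finset.coe_singleton, SimpleGraph.induce_singleton_eq_top]
  exact SimpleGraph.connected_top

/-- Connected sets through the common vertex `s` have connected union, and positive coordinates make
it a face. -/
lemma levelTube_mem_tubes {y : EuclideanSpace ℝ (Fin n)} {s : SignedIndex n}
    (hs : 0 < signedCoord y s) : levelTube G y s ∈ tubes G := by
  refine ⟨mem_cubeComplex_of_pos y fun r hr => hs.trans_le (le_of_mem_levelTube hr), ?_⟩
  let T : Set (Set (SignedIndex n)) := {A | ∃ t ∈ tubes G, s ∈ t ∧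
    (∀ q ∈ t, signedCoord y s ≤ signedCoord y q) ∧ A = (t : Set (SignedIndex n))}
  have e : (levelTube G y s : Set (SignedIndex n)) = ⋃₀ T := by
    ext r
    simp only [Finset.mem_coe, mem_levelTube, Set.mem_sUnion]
    constructor
    · rintro ⟨t, ht, hst, hle, hr⟩
      exact ⟨t, ⟨t, ht, hst, hle, rfl⟩, hr⟩
    · rintro ⟨_, ⟨t, ht, hst, hle, rfl⟩, hr⟩
      exact ⟨t, ht, hst, hle, hr⟩
  rw [e]
  refine SimpleGraph.induce_sUnion_connected_of_pairwise_not_disjoint ?_ ?_ ?_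
  · obtain ⟨t, ht, hst, hle, -⟩ := mem_levelTube.1 (self_mem_levelTube (G := G) hs)
    exact ⟨t, t, ht, hst, hle, rfl⟩
  · rintro _ _ ⟨t, -, hst, -, rfl⟩ ⟨t', -, hst', -, rfl⟩
    exact ⟨s, hst, hst'⟩
  · rintro _ ⟨t, ht, -, -, rfl⟩
    exact ht.2

lemma exists_isNested_superlevelCovered (G : HypercubeGraph n) (y : EuclideanSpace ℝ (Fin n)) :
    ∃ N, IsNested (cubeComplex n) (tubes G) N ∧ SuperlevelCovered N y := by
  classical
  set N := (Finset.univ.filter fun s => 0 < signedCoord y s).image (levelTube G y) with hNdef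
  have hmem : ∀ I, I ∈ N ↔ ∃ s, 0 < signedCoord y s ∧ levelTube G y s = I := fun I => by
    simp [hNdef]
  refine ⟨N, ⟨fun I hI => ?_, fun M hM hcard hanti => ⟨?_, fun htube => ?_⟩⟩, fun s hs =>
    ⟨_, (hmem _).2 ⟨s, hs, rfl⟩, self_mem_levelTube hs, fun r hr => le_of_mem_levelTube hr⟩⟩
  · obtain ⟨s, hs, rfl⟩ := (hmem I).1 hI
    exact levelTube_mem_tubes hs
  · refine mem_cubeComplex_of_pos y fun r hr => ?_
    obtain ⟨I, hI, hr⟩ := Finset.mem_biUnion.1 hr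
    obtain ⟨s, hs, rfl⟩ := (hmem I).1 (hM hI)
    exact hs.trans_le (le_of_mem_levelTube hr)
  -- Choose `s` of lowest level in `M`. If the union were a tube, it would be one of the tubes
  -- defining `levelTube G y s`, which would then contain every other member of the antichain.
  · obtain ⟨s, hs, hmin⟩ := (Finset.univ.filter fun s => 0 < signedCoord y s ∧
      levelTube G y s ∈ M).exists_min_image (signedCoord y) (by
        obtain ⟨I, hI⟩ := Finset.card_pos.1 (zero_lt_two.trans_le hcard)
        obtain ⟨s, hs, rfl⟩ := (hmem I).1 (hM hI)
        exact ⟨s, by simp [hs, hI]⟩)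
    simp only [Finset.mem_filter, Finset.mem_univ, true_and] at hs hmin
    obtain ⟨J, hJ, hne⟩ := Finset.exists_mem_ne hcard (levelTube G y s)
    refine hanti hJ hs.2 hne fun r hr => mem_levelTube.2 ⟨_, htube,
      Finset.mem_biUnion.2 ⟨_, hs.2, self_mem_levelTube hs.1⟩, fun q hq => ?_,
      Finset.mem_biUnion.2 ⟨J, hJ, hr⟩⟩
    obtain ⟨I, hI, hq⟩ := Finset.mem_biUnion.1 hq
    obtain ⟨p, hp, rfl⟩ := (hmem I).1 (hM hI)
    exact (hmin p ⟨hp, hI⟩).trans (le_of_mem_levelTube hq)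

theorem coarsens_hypercubeGraphFan (G : HypercubeGraph n) :
    Coarsens (hypercubeGraphFan G) (typeBCoxeterFan n) := by
  constructor
  · rintro _ ⟨x, rfl⟩
    obtain ⟨N, hN, hx⟩ := exists_isNested_superlevelCovered G x
    exact ⟨_, ⟨N, hN, rfl⟩, fun y hy => (hx.of_mem_stratumClosure hy).mem_preposetCone hN⟩
  · rintro _ ⟨N, hN, rfl⟩
    refine ⟨{C | ∃ y ∈ preposetCone (signedBasis n) (familyPreposet N),
      C = stratumClosure (typeBNormals n) y}, ?_, ?_⟩
    · rintro _ ⟨y, -, rfl⟩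
      exact stratumClosure_mem_arrangementFan _ y
    · refine Set.Subset.antisymm (fun y hy => ⟨_, ⟨y, hy, rfl⟩, self_mem_stratumClosure _ y⟩) ?_
      rintro z ⟨_, ⟨y, hy, rfl⟩, hz⟩
      exact ((SuperlevelCovered.of_mem_preposetCone hN hy).of_mem_stratumClosure
        hz).mem_preposetCone hN

end Hypercube

/-! ### The normal fan of the permutahedron -/

section Permutahedron

variable {n : ℕ}

lemma inner_single_one_left (i : Fin n) (x : EuclideanSpace ℝ (Fin n)) :
    inner ℝ (EuclideanSpace.single i (1 : ℝ)) x = x i := by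
  rw [EuclideanSpace.inner_single_left, map_one, one_mul]

/-- The signed permutations of `(1, …, n)`. -/
def signedPermutations (n : ℕ) : Set (EuclideanSpace ℝ (Fin n)) :=
  {x | ∃ (σ : Equiv.Perm (Fin n)) (ε : Fin n → ℤˣ),
    ∀ i, x i = ((ε i : ℤ) : ℝ) * (((σ i : ℕ) : ℝ) + 1)}

lemma typeBPermutahedron_eq (n : ℕ) :
    typeBPermutahedron n = convexHull ℝ (signedPermutations n) := rfl

lemma finite_signedPermutations (n : ℕ) : (signedPermutations n).Finite := by
  refine (Set.finite_range fun p : Equiv.Perm (Fin n) × (Fin n → ℤˣ) =>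
    (WithLp.toLp 2 fun i => ((p.2 i : ℤ) : ℝ) * (((p.1 i : ℕ) : ℝ) + 1) :
      EuclideanSpace ℝ (Fin n))).subset ?_
  rintro x ⟨σ, ε, h⟩
  exact ⟨(σ, ε), by ext i; simp [h]⟩

lemma signedPermutations_nonempty (n : ℕ) : (signedPermutations n).Nonempty :=
  ⟨WithLp.toLp 2 fun i => ((i : ℕ) : ℝ) + 1, 1, 1, fun i => by simp⟩

lemma abs_signed (ε : ℤˣ) (m : ℕ) : |((ε : ℤ) : ℝ) * ((m : ℝ) + 1)| = (m : ℝ) + 1 := by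
  have : (0 : ℝ) < (m : ℝ) + 1 := by positivity
  rcases Int.units_eq_one_or ε with rfl | rfl
  · simp [abs_of_pos this]
  · rw [Units.val_neg, Units.val_one, Int.cast_neg, Int.cast_one, neg_one_mul, abs_neg,
      abs_of_pos this]

/-- The absolute values of the coordinates are nonzero and distinct. -/
lemma inner_ne_zero_of_mem_signedPermutations {p a : EuclideanSpace ℝ (Fin n)}
    (hp : p ∈ signedPermutations n) (ha : a ∈ typeBNormals n) : inner ℝ a p ≠ 0 := by
  obtain ⟨σ, ε, h⟩ := hp
  have habs : ∀ i, |p i| = ((σ i : ℕ) : ℝ) + 1 := fun i => by rw [h, abs_signed]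
  have hne : ∀ i j, i ≠ j → |p i| ≠ |p j| := fun i j hij e => by
    rw [habs, habs] at e
    exact hij (σ.injective (Fin.ext (Nat.cast_injective (add_right_cancel e))))
  rcases ha with ⟨i, rfl⟩ | ⟨i, j, hij, rfl | rfl⟩
  · simp only [inner_single_one_left]
    intro e
    have := habs i
    rw [e, abs_zero] at this
    exact (Nat.cast_add_one_pos (α := ℝ) (σ i : ℕ)).ne this
  · simp only [inner_sub_left, inner_single_one_left]
    exact fun e => hne i j hij (by rw [sub_eq_zero.1 e])
  · simp only [inner_add_left, inner_single_one_left]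
    exact fun e => hne i j hij (by rw [eq_neg_of_add_eq_zero_left e, abs_neg])

/-- The signed permutations are stable under the reflections in the type `B` hyperplanes. -/
lemma exists_reflection {p a : EuclideanSpace ℝ (Fin n)}
    (hp : p ∈ signedPermutations n) (ha : a ∈ typeBNormals n) :
    ∃ q ∈ signedPermutations n, ∃ c : ℝ, 0 < c ∧ p - q = (c * inner ℝ a p) • a := by
  obtain ⟨σ, ε, h⟩ := hp
  rcases ha with ⟨i, rfl⟩ | ⟨i, j, hij, rfl | rfl⟩
  -- The constant is `2 / ⟪a, a⟫`: it is `2` here and `1` for the two longer normals below.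
  · refine ⟨p - (2 * p i) • EuclideanSpace.single i 1,
      ⟨σ, Function.update ε i (-ε i), fun k => ?_⟩, 2, two_pos, by simp [inner_single_one_left]⟩
    by_cases hk : k = i
    · subst hk
      simp [h]
      ring
    · simp [h, hk]
  · refine ⟨p - (p i - p j) • (EuclideanSpace.single i 1 - EuclideanSpace.single j 1),
      ⟨Equiv.swap i j |>.trans σ, ε ∘ Equiv.swap i j, fun k => ?_⟩, 1, one_pos,
      by rw [inner_sub_left, inner_single_one_left, inner_single_one_left, one_mul,
        sub_sub_cancel]⟩
    by_cases hki : k = i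
    · subst hki
      simp [h, hij]
    · by_cases hkj : k = j
      · subst hkj
        simp [h, hki]
      · simp [h, hki, hkj, Equiv.swap_apply_of_ne_of_ne]
  · refine ⟨p - (p i + p j) • (EuclideanSpace.single i 1 + EuclideanSpace.single j 1),
      ⟨Equiv.swap i j |>.trans σ,
        fun k => if k = i ∨ k = j then -ε (Equiv.swap i j k) else ε k, fun k => ?_⟩, 1, one_pos,
      by rw [inner_add_left, inner_single_one_left, inner_single_one_left, one_mul,
        sub_sub_cancel]⟩
    by_cases hki : k = i
    · subst hki
      simp [h, hij]
    · by_cases hkj : k = j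
      · subst hkj
        simp [h, hki]
      · simp [h, hki, hkj, Equiv.swap_apply_of_ne_of_ne]

/-- The rearrangement inequality for signed permutations. -/
lemma inner_le_of_forall_root {p q y : EuclideanSpace ℝ (Fin n)}
    (hp : p ∈ signedPermutations n) (hq : q ∈ signedPermutations n)
    (h : ∀ a ∈ typeBNormals n, 0 ≤ inner ℝ a p * inner ℝ a y) :
    inner ℝ y q ≤ inner ℝ y p := by
  have h1 : ∀ i, 0 ≤ p i * y i := fun i => by
    simpa only [inner_single_one_left] using h _ (Or.inl ⟨i, rfl⟩)
  have h2 : ∀ i j, i ≠ j → 0 ≤ (p i - p j) * (y i - y j) := fun i j hij => by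
    simpa only [inner_sub_left, inner_single_one_left] using h _ (Or.inr ⟨i, j, hij, Or.inl rfl⟩)
  have h3 : ∀ i j, i ≠ j → 0 ≤ (p i + p j) * (y i + y j) := fun i j hij => by
    simpa only [inner_add_left, inner_single_one_left] using h _ (Or.inr ⟨i, j, hij, Or.inr rfl⟩)
  obtain ⟨σ, ε, hσ⟩ := hp
  obtain ⟨τ, δ, hτ⟩ := hq
  have hpabs : ∀ i, |p i| = ((σ i : ℕ) : ℝ) + 1 := fun i => by rw [hσ, abs_signed]
  have hqabs : ∀ i, |q i| = |p ((τ.trans σ.symm) i)| := fun i => by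
    rw [hτ, abs_signed, hpabs]
    simp
  -- If `|p i| < |p j|`, then `p j ± p i` have the sign of `p j`; the hypotheses transfer this
  -- weakly to `y j ± y i`.
  have hmono : Monovary (fun i => |y i|) fun i => |p i| := by
    intro i j hij
    have hne : i ≠ j := fun e => by simp [e] at hij
    have hy := h1 j
    have hsub := h2 j i hne.symm
    have hadd := h3 j i hne.symm
    rcases lt_or_ge 0 (p j) with hj | hj
    · simp only [abs_of_pos hj] at hij
      obtain ⟨ha, hb⟩ := abs_lt.1 hij
      have e1 := nonneg_of_mul_nonneg_right hsub (by linarith)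
      have e2 := nonneg_of_mul_nonneg_right hadd (by linarith)
      exact (abs_le.2 ⟨by linarith, by linarith⟩ : |y i| ≤ y j).trans (le_abs_self _)
    · simp only [abs_of_nonpos hj] at hij
      obtain ⟨ha, hb⟩ := abs_lt.1 hij
      have e1 : 0 ≤ y i - y j :=
        nonneg_of_mul_nonneg_right (a := p i - p j) (by linarith) (by linarith)
      have e2 : 0 ≤ -(y j + y i) :=
        nonneg_of_mul_nonneg_right (a := -(p j + p i)) (by linarith) (by linarith)
      exact (abs_le.2 ⟨by linarith, by linarith⟩ : |y i| ≤ -y j).trans (neg_le_abs _)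
  have hsum := hmono.sum_smul_comp_perm_le_sum_smul (σ := τ.trans σ.symm)
  simp only [smul_eq_mul] at hsum
  calc inner ℝ y q = ∑ i, y i * q i := by simp [PiLp.inner_apply, mul_comm]
    _ ≤ ∑ i, |y i| * |p ((τ.trans σ.symm) i)| := Finset.sum_le_sum fun i _ => by
        rw [← hqabs, ← abs_mul]; exact le_abs_self _
    _ ≤ ∑ i, |y i| * |p i| := hsum
    _ = ∑ i, y i * p i := Finset.sum_congr rfl fun i _ => by
        rw [← abs_mul, mul_comm, abs_of_nonneg (h1 i)]
    _ = inner ℝ y p := by simp [PiLp.inner_apply, mul_comm]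

end Permutahedron

/-! ### Faces and normal fans of polytopes -/

section ConvexHull

variable {E : Type*} [NormedAddCommGroup E] [InnerProductSpace ℝ E]

lemma mem_maxFace_convexHull {V : Set E} {v p : E} (hp : p ∈ V)
    (h : ∀ q ∈ V, inner ℝ v q ≤ inner ℝ v p) : p ∈ maxFace (convexHull ℝ V) v := by
  refine ⟨subset_convexHull ℝ V hp, fun y hy => ?_⟩
  have hc : Convex ℝ {x : E | inner ℝ v x ≤ inner ℝ v p} :=
    convex_halfSpace_le (innerₛₗ ℝ v).isLinear _
  exact convexHull_min h hc hy

lemma isExposed_maxFace (P : Set E) (v : E) : IsExposed ℝ P (maxFace P v) :=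
  fun _ => ⟨innerSL ℝ v, rfl⟩

lemma convex_maxFace {P : Set E} (hP : Convex ℝ P) (v : E) : Convex ℝ (maxFace P v) :=
  (isExposed_maxFace P v).convex hP

/-- A face of a polytope is contained in another one if this holds for their vertices. -/
lemma maxFace_subset_maxFace {V : Set E} (hV : V.Finite) {x y : E}
    (h : ∀ p ∈ V, p ∈ maxFace (convexHull ℝ V) x → p ∈ maxFace (convexHull ℝ V) y) :
    maxFace (convexHull ℝ V) x ⊆ maxFace (convexHull ℝ V) y := by
  have hcomp := hV.isCompact_convexHull (𝕜 := ℝ)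
  have hx := isExposed_maxFace (convexHull ℝ V) x
  have hy := isExposed_maxFace (convexHull ℝ V) y
  -- Krein–Milman: the exposed face is the closed hull of its extreme points, which are extreme in
  -- the polytope and so lie in `V`.
  rw [← closure_convexHull_extremePoints (hx.isCompact hcomp)
    (convex_maxFace (convex_convexHull ℝ V) x)]
  refine closure_minimal (convexHull_min (fun p hp => ?_)
    (convex_maxFace (convex_convexHull ℝ V) y)) (hy.isCompact hcomp).isClosed
  exact h p (extremePoints_convexHull_subset (hx.isExtreme.extremePoints_subset_extremePoints hp))
    hp.1

lemma normalFan_eq_range [CompleteSpace E] {P : Set E} (hP : IsCompact P) (hne : P.Nonempty) :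
    normalFan P = Set.range fun x => normalCone P (maxFace P x) := by
  ext C
  constructor
  · rintro ⟨F, ⟨hF, hexp⟩, rfl⟩
    obtain ⟨l, hl⟩ := hexp hF
    refine ⟨(InnerProductSpace.toDual ℝ E).symm l, ?_⟩
    have : maxFace P ((InnerProductSpace.toDual ℝ E).symm l) = F := by
      rw [hl]
      simp [maxFace]
    simp only [this]
  · rintro ⟨x, rfl⟩
    refine ⟨_, ⟨?_, isExposed_maxFace P x⟩, rfl⟩
    obtain ⟨p, hp, hmax⟩ := hP.exists_isMaxOn hne
      (continuous_const.inner continuous_id : Continuous fun z : E => inner ℝ x z).continuousOn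
    exact ⟨p, hp, fun q hq => hmax hq⟩

lemma isPolytope_of_forall_mem_normalCone [FiniteDimensional ℝ E] {P : Set E}
    (hP : IsPolyhedron P) (h : ∀ v : E, ∃ F, IsFace P F ∧ v ∈ normalCone P F) : IsPolytope P := by
  refine ⟨hP, ?_⟩
  have hb : ∀ v : E, ∃ b : ℝ, ∀ x ∈ P, inner ℝ v x ≤ b := fun v => by
    obtain ⟨F, ⟨⟨z, hz⟩, -⟩, hv⟩ := h v
    exact ⟨inner ℝ v z, (hv hz).2⟩
  let B := stdOrthonormalBasis ℝ E
  choose b hb using hb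
  refine isBounded_iff_forall_norm_le.2
    ⟨∑ i, (|b (B i)| + |b (-B i)|), fun x hx => ?_⟩
  calc ‖x‖ = ‖∑ i, inner ℝ (B i) x • B i‖ := by rw [B.sum_repr' x]
    _ ≤ ∑ i, ‖inner ℝ (B i) x • B i‖ := norm_sum_le _ _
    _ ≤ _ := Finset.sum_le_sum fun i _ => by
      rw [norm_smul, B.norm_eq_one, mul_one, Real.norm_eq_abs]
      have h1 := hb (B i) x hx
      have h2 := hb (-B i) x hx
      rw [inner_neg_left] at h2
      have h3 := le_abs_self (b (B i))
      have h4 := le_abs_self (b (-B i))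
      have h5 := abs_nonneg (b (B i))
      have h6 := abs_nonneg (b (-B i))
      exact abs_le.2 ⟨by linarith, by linarith⟩

end ConvexHull

lemma normalCone_typeBPermutahedron {n : ℕ} (x : EuclideanSpace ℝ (Fin n)) :
    normalCone (typeBPermutahedron n) (maxFace (typeBPermutahedron n) x) =
      stratumClosure (typeBNormals n) x := by
  rw [typeBPermutahedron_eq]
  have hroot : ∀ p ∈ signedPermutations n, ∀ z,
      p ∈ maxFace (convexHull ℝ (signedPermutations n)) z →
      ∀ a ∈ typeBNormals n, 0 ≤ inner ℝ a p * inner ℝ a z := by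
    intro p hp z hz a ha
    obtain ⟨q, hq, c, hc, e⟩ := exists_reflection hp ha
    have h1 := hz.2 q (subset_convexHull ℝ _ hq)
    have h2 : 0 ≤ inner ℝ z (p - q) := by rw [inner_sub_right]; linarith
    rw [e, inner_smul_right, real_inner_comm a z, mul_assoc] at h2
    exact nonneg_of_mul_nonneg_right h2 hc
  ext y
  constructor
  · intro hy
    obtain ⟨p, hp, hmax⟩ := Set.exists_max_image _ (fun q => inner ℝ x q)
      (finite_signedPermutations n) (signedPermutations_nonempty n)
    have hpx := mem_maxFace_convexHull hp hmax
    have hpy := hy hpx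
    intro a ha
    have hx' := hroot p hp x hpx a ha
    have hy' := hroot p hp y hpy a ha
    refine ⟨fun h0 => ?_, fun hpos => ?_, fun hneg => ?_⟩
    -- If `x` is orthogonal to `a`, then `p` and its reflection both maximize `x`, hence both
    -- maximize `y`, which forces `y` orthogonal to `a`.
    · obtain ⟨q, hq, c, hc, e⟩ := exists_reflection hp ha
      have hqx : inner ℝ x q = inner ℝ x p := by
        have h1 : inner ℝ x (p - q) = 0 := by
          rw [e, inner_smul_right, real_inner_comm a x, h0, mul_zero]
        rw [inner_sub_right] at h1
        linarith
      have hqy := hy (mem_maxFace_convexHull hq fun r hr => hqx ▸ hmax r hr)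
      have h1 : inner ℝ y (p - q) = 0 := by
        rw [inner_sub_right, sub_eq_zero]
        exact le_antisymm (hqy.2 p hpy.1) (hpy.2 q hqy.1)
      rw [e, inner_smul_right, real_inner_comm a y] at h1
      exact (mul_eq_zero.1 h1).resolve_left
        (mul_ne_zero hc.ne' (inner_ne_zero_of_mem_signedPermutations hp ha))
    · have hne := inner_ne_zero_of_mem_signedPermutations hp ha
      have hp' := hne.symm.lt_of_le (nonneg_of_mul_nonneg_left hx' hpos)
      exact nonneg_of_mul_nonneg_right hy' hp'
    · have hne := inner_ne_zero_of_mem_signedPermutations hp ha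
      have hp' := hne.lt_of_le (nonpos_of_mul_nonneg_left hx' hneg)
      exact nonpos_of_mul_nonneg_right hy' hp'
  · intro hy
    refine maxFace_subset_maxFace (finite_signedPermutations n) fun p hp hpx => ?_
    refine mem_maxFace_convexHull hp fun q hq => inner_le_of_forall_root hp hq fun a ha => ?_
    have h := hroot p hp x hpx a ha
    have hne := inner_ne_zero_of_mem_signedPermutations hp ha
    rcases hne.lt_or_gt with hlt | hgt
    · exact mul_nonneg_of_nonpos_of_nonpos hlt.le (inner_nonpos_of_mem_stratumClosure ha hy
        (nonpos_of_mul_nonneg_right h hlt))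
    · exact mul_nonneg hgt.le (inner_nonneg_of_mem_stratumClosure ha hy
        (nonneg_of_mul_nonneg_right h hgt))

lemma normalFan_typeBPermutahedron (n : ℕ) :
    normalFan (typeBPermutahedron n) = typeBCoxeterFan n := by
  rw [typeBPermutahedron_eq, normalFan_eq_range
    ((finite_signedPermutations n).isCompact_convexHull (𝕜 := ℝ))
    (signedPermutations_nonempty n).convexHull]
  ext C
  simp only [Set.mem_range, ← typeBPermutahedron_eq, normalCone_typeBPermutahedron]
  exact ⟨fun ⟨x, h⟩ => ⟨x, h.symm⟩, fun ⟨x, h⟩ => ⟨x, h.symm⟩⟩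

end NestedFan

theorem mainTheorem8 (n : ℕ) (G : NestedFan.HypercubeGraph n) :
    NestedFan.Coarsens (NestedFan.hypercubeGraphFan G) (NestedFan.typeBCoxeterFan n) ∧
    ∀ P : Set (EuclideanSpace ℝ (Fin n)), NestedFan.IsStandardCut G P →
      NestedFan.Coarsens (NestedFan.normalFan P) (NestedFan.typeBCoxeterFan n) ∧
      NestedFan.IsDeformation P (NestedFan.typeBPermutahedron n) := by
  have h := NestedFan.coarsens_hypercubeGraphFan G
  refine ⟨h, fun P hP => ?_⟩
  rw [← hP.2] at h
  refine ⟨h, NestedFan.isPolytope_of_forall_mem_normalCone hP.1.1.1 fun v => ?_,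
    NestedFan.normalFan_typeBPermutahedron n ▸ h⟩
  obtain ⟨_, ⟨F, hF, rfl⟩, hsub⟩ :=
    h.1 _ (NestedFan.stratumClosure_mem_arrangementFan (NestedFan.typeBNormals n) v)
  exact ⟨F, hF, hsub (NestedFan.self_mem_stratumClosure _ v)⟩
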